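/- Let $p$ be a prime and let $k, d \ge 1$ be integers. The Galois ring $R = \mathrm{GR}(p^k, d)$ is, up to isomorphism, the ring $(\mathbb{Z}/p^k\mathbb{Z})[X]/(f)$, where $f$ is a monic polynomial of degree $d$ with integer coefficients whose reduction modulo $p$ is irreducible over $\mathbb{F}_p$. The exponential period $\mu_1 = \mu_1(R)$ is the least positive integer $n$ such that for every $x \in R$ there is a positive integer $m = m(x)$ with $x^{m+n} = x^m$. The onset of exponential periodicity is $\mu_0 = \mu_0(R) = \max_{x \in R} \min\{m \ge 1 : x^{m + \mu_1} = x^m\}$. A power map over $R$ is a function $R \to R$ of the form $x \mapsto x^n$ with $n \ge 1$ an integer; two power maps are distinct if they differ as functions. A power map $f$ is periodic if there is $h \in R \setminus \{0\}$ with $f(x + h) = f(x)$ for all $x \in R$. Let $\mu_P = \mu_P(R)$ be the number of distinct periodic power maps over $R$. (1) If $d, k \ge 2$, then $\mu_0 = k$ and $\mu_1 = p^{k-1}(p^d - 1)$; there are exactly $p^{k-1}(p^d-1) + k - 1$ distinct power maps over $R$, and $$\mu_P = p^{k-2}(p^d - 1) + \left\lfloor \frac{k-1}{p} \right\rfloor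 .$$ (2) If $k = 1$, then $R \cong \mathbb{F}_{p^d}$, $\mu_0 = 1$ and $\mu_1 = p^d - 1$; there are exactly $p^d - 1$ distinct power maps over $R$, and none of them is periodic. -/

import Mathlib

open Polynomial

/-- `R` is (a copy of) the Galois ring `GR(p ^ k, d)`: for some monic `f ∈ ℤ[X]` of degree `d`
whose reduction modulo `p` is irreducible, `R` is isomorphic to `(ℤ / p ^ k)[X] / (f)`. -/
def IsGaloisRing (p k d : ℕ) (R : Type*) [CommRing R] : Prop :=
  ∃ f : ℤ[X], f.Monic ∧ f.natDegree = d ∧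
    Irreducible (f.map (Int.castRingHom (ZMod p))) ∧
    Nonempty (R ≃+* AdjoinRoot (f.map (Int.castRingHom (ZMod (p ^ k)))))

/-- Galois rings exist for all primes `p`, all `k`, and all degrees `d ≥ 1`. -/
theorem exists_isGaloisRing (p k d : ℕ) [Fact p.Prime] (hd : d ≠ 0) :
    ∃ g : (ZMod (p ^ k))[X], IsGaloisRing p k d (AdjoinRoot g) := by
  obtain ⟨α, hα⟩ := Field.exists_primitive_element (ZMod p) (GaloisField p d)
  have hint : IsIntegral (ZMod p) α := Algebra.IsIntegral.isIntegral α
  have hdeg : (minpoly (ZMod p) α).natDegree = d := by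
    exact ((Field.primitive_element_iff_minpoly_natDegree_eq (ZMod p) α).1 hα).trans
      (GaloisField.finrank p hd)
  have hl : minpoly (ZMod p) α ∈ Polynomial.lifts (Int.castRingHom (ZMod p)) := by
    rw [Polynomial.lifts_iff_coeff_lifts]
    intro n
    exact ZMod.intCast_surjective _
  obtain ⟨f, hf, hfd, hfm⟩ :=
    Polynomial.lifts_and_natDegree_eq_and_monic hl (minpoly.monic hint)
  refine ⟨f.map (Int.castRingHom (ZMod (p ^ k))), f, hfm, hfd.trans hdeg, ?_,
    ⟨RingEquiv.refl _⟩⟩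
  rw [hf]
  exact minpoly.irreducible hint

/-- `N` is the exponential period `μ₁` of `R`: the least positive integer such that for every
`x` there is a positive integer `m`, which may depend on `x`, with `x ^ (m + N) = x ^ m`. -/
def HasExpPeriod (R : Type*) [Monoid R] (N : ℕ) : Prop :=
  IsLeast {n : ℕ | 0 < n ∧ ∀ x : R, ∃ m : ℕ, 0 < m ∧ x ^ (m + n) = x ^ m} N

/-- `M` is the onset of exponential periodicity `μ₀` of `R`: the maximum over `x` of the least
positive integer `m` with `x ^ (m + μ₁) = x ^ m`. -/
def HasExpOnset (R : Type*) [Monoid R] (M : ℕ) : Prop :=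
  ∃ N : ℕ, HasExpPeriod R N ∧
    IsGreatest {m : ℕ | ∃ x : R, IsLeast {j : ℕ | 0 < j ∧ x ^ (j + N) = x ^ j} m} M

/-- The set of power maps `x ↦ x ^ n`, `n ≥ 1`, as functions on `R`. -/
def powerMaps (R : Type*) [Monoid R] : Set (R → R) :=
  {f | ∃ n : ℕ, 0 < n ∧ f = fun x => x ^ n}

/-- The set of power maps on `R` that have a nonzero additive period. -/
def periodicPowerMaps (R : Type*) [Ring R] : Set (R → R) :=
  {f | f ∈ powerMaps R ∧ ∃ h : R, h ≠ 0 ∧ Function.Periodic f h}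

/-! `R` is local with maximal ideal `(p)`, residue field of order `p ^ d`, and `p` nilpotent of
index exactly `k`; the counts use only this and the exponent `L` of the unit group. Non-units die at
the `k`-th power, so for `m < n` the maps `x ^ n` and `x ^ m` agree iff `k ≤ m` and `L ∣ n - m`
(`forall_pow_eq_pow_iff`). Thus the exponents `1, …, L + k - 1` list each power map once. For `k ≥
2` the periodic ones are those with `p ∣ n` (`exists_periodic_pow_iff`), so they number `(L + k - 1)
/ p`. The value `L = p ^ (k - 1) * (p ^ d - 1)` comes from a generator of `Fˣ` and a principal unit
of order `p ^ (k - 1)`; only the latter needs `d ≥ 2`, and only when `p = 2`. -/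

/-- `π : R → F` is the reduction modulo `p` of a ring in which `p` is nilpotent of index `k`, and
in which only multiples of `p` are killed by `p ^ (k - 1)`. -/
structure IsReduction {R F : Type*} [CommRing R] [Field F] (p k : ℕ) (π : R →+* F) : Prop where
  surjective : Function.Surjective π
  map_eq_zero_iff : ∀ x, π x = 0 ↔ (p : R) ∣ x
  pow_eq_zero : (p : R) ^ k = 0
  dvd_of_mul_eq_zero : ∀ x, (p : R) ^ (k - 1) * x = 0 → (p : R) ∣ x

/-! ### Reduction of a Galois ring modulo `p` -/

theorem map_dvd_map_intCast_iff (N : ℕ) (f g : ℤ[X]) :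
    f.map (Int.castRingHom (ZMod N)) ∣ g.map (Int.castRingHom (ZMod N)) ↔
      ∃ h r : ℤ[X], g = f * h + C (N : ℤ) * r := by
  constructor
  · rintro ⟨q, hq⟩
    obtain ⟨h, rfl⟩ := Polynomial.map_surjective (Int.castRingHom (ZMod N))
      ZMod.intCast_surjective q
    have hr : C (N : ℤ) ∣ g - f * h := by
      rw [Polynomial.C_dvd_iff_dvd_coeff]
      intro i
      rw [← ZMod.intCast_zmod_eq_zero_iff_dvd]
      have : (g - f * h).map (Int.castRingHom (ZMod N)) = 0 := by
        rw [Polynomial.map_sub, Polynomial.map_mul, hq, sub_self]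
      have := congrArg (fun q => q.coeff i) this
      rwa [Polynomial.coeff_map, eq_intCast] at this
    obtain ⟨r, hr⟩ := hr
    exact ⟨h, r, by rw [← hr]; ring⟩
  · rintro ⟨h, r, rfl⟩
    exact ⟨h.map (Int.castRingHom (ZMod N)), by simp⟩

theorem natCast_dvd_of_dvd_monic_mul (N : ℕ) {f h : ℤ[X]} (hf : f.Monic)
    (hd : C (N : ℤ) ∣ f * h) : C (N : ℤ) ∣ h := by
  have key : ∀ q : ℤ[X], C (N : ℤ) ∣ q ↔ q.map (Int.castRingHom (ZMod N)) = 0 := by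
    intro q
    rw [Polynomial.C_dvd_iff_dvd_coeff, Polynomial.ext_iff]
    simp [ZMod.intCast_zmod_eq_zero_iff_dvd]
  rw [key] at hd ⊢
  rw [Polynomial.map_mul] at hd
  exact (hf.map _).mul_right_eq_zero_iff.1 hd

theorem IsGaloisRing.ne_zero {p k d : ℕ} {R : Type*} [CommRing R] [Fact p.Prime]
    (hR : IsGaloisRing p k d R) : d ≠ 0 := by
  obtain ⟨f, hf, rfl, hirr, -⟩ := hR
  intro h0
  rw [hf.natDegree_eq_zero.1 h0] at hirr
  simp at hirr

/-- Both rings are quotients of `ℤ[X]`, with kernels `(f, p ^ k)` and `(f, p)`, so divisibility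
questions move to `ℤ[X]`, where powers of `p` cancel. -/
theorem IsGaloisRing.exists_isReduction {p k d : ℕ} {R : Type*} [CommRing R] [Fact p.Prime]
    (hR : IsGaloisRing p k d R) (hk : 1 ≤ k) :
    ∃ (F : Type) (_ : Field F) (π : R →+* F), Nat.card F = p ^ d ∧ IsReduction p k π := by
  obtain ⟨f, hf, rfl, hirr, ⟨e⟩⟩ := hR
  set fp := f.map (Int.castRingHom (ZMod p)) with hfp
  set fk := f.map (Int.castRingHom (ZMod (p ^ k))) with hfk
  have : Fact (Irreducible fp) := ⟨hirr⟩
  let ψ : ℤ[X] →+* R := (e.symm : AdjoinRoot fk →+* R).comp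
    ((AdjoinRoot.mk fk).comp (Polynomial.mapRingHom (Int.castRingHom (ZMod (p ^ k)))))
  let φ : ℤ[X] →+* AdjoinRoot fp :=
    (AdjoinRoot.mk fp).comp (Polynomial.mapRingHom (Int.castRingHom (ZMod p)))
  have hψs : Function.Surjective ψ := e.symm.surjective.comp (AdjoinRoot.mk_surjective.comp
    (Polynomial.map_surjective _ ZMod.intCast_surjective))
  have hφs : Function.Surjective φ := AdjoinRoot.mk_surjective.comp
    (Polynomial.map_surjective _ ZMod.intCast_surjective)
  have hψ : ∀ g, ψ g = 0 ↔ ∃ h r : ℤ[X], g = f * h + C ((p ^ k : ℕ) : ℤ) * r := by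
    intro g
    rw [← map_dvd_map_intCast_iff, ← AdjoinRoot.mk_eq_zero]
    simp [ψ, hfk]
  have hφ : ∀ g, φ g = 0 ↔ ∃ h r : ℤ[X], g = f * h + C (p : ℤ) * r := by
    intro g
    rw [← map_dvd_map_intCast_iff, ← AdjoinRoot.mk_eq_zero]
    simp [φ, hfp]
  have hψf : ψ f = 0 := (hψ f).2 ⟨1, 0, by simp⟩
  have hCp : ∀ n : ℕ, ψ (C (n : ℤ)) = n := fun n => by simp
  have hker : RingHom.ker ψ ≤ RingHom.ker φ := by
    intro g hg
    rw [RingHom.mem_ker] at hg ⊢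
    obtain ⟨h, r, rfl⟩ := (hψ g).1 hg
    refine (hφ _).2 ⟨h, C ((p ^ (k - 1) : ℕ) : ℤ) * r, ?_⟩
    rw [← mul_assoc, ← C_mul, ← Nat.cast_mul, ← pow_succ', Nat.sub_add_cancel hk]
  let π : R →+* AdjoinRoot fp := RingHom.liftOfSurjective ψ hψs ⟨φ, hker⟩
  have hπ : ∀ g, π (ψ g) = φ g := fun g =>
    RingHom.liftOfRightInverse_comp_apply ψ _ (Function.rightInverse_surjInv hψs) ⟨φ, hker⟩ g
  refine ⟨AdjoinRoot fp, inferInstance, π, ?_, ⟨?_, ?_, ?_, ?_⟩⟩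
  · have hm : fp.Monic := hf.map _
    have := hm.finite_adjoinRoot
    rw [Module.natCard_eq_pow_finrank (K := ZMod p), (AdjoinRoot.powerBasis' hm).finrank,
      AdjoinRoot.powerBasis'_dim, Nat.card_zmod, hfp, hf.natDegree_map]
  · intro y
    obtain ⟨g, rfl⟩ := hφs y
    exact ⟨ψ g, hπ g⟩
  · intro x
    obtain ⟨g, rfl⟩ := hψs x
    rw [hπ, hφ]
    constructor
    · rintro ⟨h, r, rfl⟩
      exact ⟨ψ r, by rw [map_add, map_mul, map_mul, hψf, hCp]; ring⟩
    · rintro ⟨y, hy⟩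
      obtain ⟨r, rfl⟩ := hψs y
      have : ψ (g - C (p : ℤ) * r) = 0 := by rw [map_sub, map_mul, hCp, hy, sub_self]
      obtain ⟨h, s, hs⟩ := (hφ _).1 (hker this)
      exact ⟨h, s + r, by rw [← sub_add_cancel g (C (p : ℤ) * r), hs]; ring⟩
  · have := (hψ (C ((p ^ k : ℕ) : ℤ))).2 ⟨0, 1, by simp⟩
    rw [hCp] at this
    exact_mod_cast this
  · intro x hx
    obtain ⟨g, rfl⟩ := hψs x
    have h1 : ψ (C ((p ^ (k - 1) : ℕ) : ℤ) * g) = 0 := by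
      rw [map_mul, hCp]
      exact_mod_cast hx
    obtain ⟨h, r, hr⟩ := (hψ _).1 h1
    have hpk : C ((p ^ k : ℕ) : ℤ) = C ((p ^ (k - 1) : ℕ) : ℤ) * C (p : ℤ) := by
      rw [← C_mul, ← Nat.cast_mul, ← pow_succ, Nat.sub_add_cancel hk]
    -- The monic `f` is a non-zero-divisor modulo `p ^ (k - 1)`, so this power divides `h` and
    -- cancels from `hr`.
    obtain ⟨h', rfl⟩ : C ((p ^ (k - 1) : ℕ) : ℤ) ∣ h := by
      refine natCast_dvd_of_dvd_monic_mul _ hf ⟨g - C (p : ℤ) * r, ?_⟩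
      rw [mul_sub, hr, hpk]; ring
    have hne : (C ((p ^ (k - 1) : ℕ) : ℤ) : ℤ[X]) ≠ 0 := by
      rw [Ne, C_eq_zero, Nat.cast_eq_zero]
      exact pow_ne_zero _ (Fact.out : p.Prime).ne_zero
    have hg : g = f * h' + C (p : ℤ) * r := by
      apply mul_left_cancel₀ hne
      rw [hr, hpk]; ring
    exact ⟨ψ r, by rw [hg, map_add, map_mul, map_mul, hψf, hCp]; ring⟩

/-! ### Units, nilpotents and the exponent of the unit group -/

namespace IsReduction

variable {R F : Type*} [CommRing R] [Field F] {p k : ℕ} {π : R →+* F}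

theorem isUnit_iff (hπ : IsReduction p k π) {x : R} : IsUnit x ↔ ¬ (p : R) ∣ x := by
  rw [← hπ.map_eq_zero_iff]
  refine ⟨fun h => (h.map π).ne_zero, fun h => ?_⟩
  obtain ⟨y, hy⟩ := hπ.surjective (π x)⁻¹
  obtain ⟨z, hz⟩ := (hπ.map_eq_zero_iff (1 - x * y)).1 (by simp [hy, h])
  have hnil : IsNilpotent (1 - x * y) := ⟨k, by rw [hz, mul_pow, hπ.pow_eq_zero, zero_mul]⟩
  have := hnil.isUnit_one_sub
  rw [sub_sub_cancel] at this
  exact isUnit_of_mul_isUnit_left this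

theorem map_natCast_eq_zero (hπ : IsReduction p k π) : (p : F) = 0 := by
  simpa using (hπ.map_eq_zero_iff p).2 dvd_rfl

theorem not_dvd_one (hπ : IsReduction p k π) : ¬ (p : R) ∣ 1 := by
  rw [← hπ.map_eq_zero_iff]; simp

theorem pow_pred_ne_zero (hπ : IsReduction p k π) : (p : R) ^ (k - 1) ≠ 0 := fun h =>
  hπ.not_dvd_one (hπ.dvd_of_mul_eq_zero 1 (by rw [h, zero_mul]))

theorem pow_eq_zero_of_dvd (hπ : IsReduction p k π) {x : R} (hx : (p : R) ∣ x) {m : ℕ}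
    (hm : k ≤ m) : x ^ m = 0 := by
  obtain ⟨y, rfl⟩ := hx
  exact pow_eq_zero_of_le hm (by rw [mul_pow, hπ.pow_eq_zero, zero_mul])

theorem pow_eq_pow_imp_le (hπ : IsReduction p k π) {m n : ℕ} (hmn : m < n)
    (h : (p : R) ^ n = (p : R) ^ m) : k ≤ m := by
  by_contra! hlt
  apply hπ.pow_pred_ne_zero
  apply pow_eq_zero_of_le (Nat.le_sub_one_of_lt hlt)
  have hnil : IsNilpotent ((p : R) ^ (n - m)) :=
    IsNilpotent.pow_of_pos ⟨k, hπ.pow_eq_zero⟩ (by omega)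
  -- `p ^ m * (1 - p ^ (n - m)) = 0` with a unit as second factor.
  refine hnil.isUnit_one_sub.mul_left_eq_zero.1 ?_
  rw [mul_sub, ← pow_add, Nat.add_sub_cancel' hmn.le, h, mul_one, sub_self]

theorem pow_prime_pow_eq_one (hπ : IsReduction p k π) (hk : 1 ≤ k) {x : R}
    (hx : (p : R) ∣ x - 1) : x ^ p ^ (k - 1) = 1 := by
  have := dvd_sub_pow_of_dvd_sub hx (k - 1)
  rw [Nat.sub_add_cancel hk, hπ.pow_eq_zero, zero_dvd_iff, one_pow, sub_eq_zero] at this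
  exact this

/-- For odd `p`, `1 + p` works. For `p = 2`, `(1 + 2w) ^ 2 = 1 + 4(w + w ^ 2)`, so `w + w ^ 2` must
be a unit: the residue of `w` must avoid `0` and `-1`, which takes more than two residues. -/
theorem exists_one_add_pow_ne_one [Fact p.Prime] (hπ : IsReduction p k π) (hk : 2 ≤ k)
    (hF : 2 < Nat.card F) : ∃ x : R, (p : R) ∣ x - 1 ∧ x ^ p ^ (k - 2) ≠ 1 := by
  have hp : p.Prime := Fact.out
  have finish : ∀ (x a : R), ¬ (p : R) ∣ a → x = 1 + (p : R) ^ (k - 1) * a → x ≠ 1 := by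
    rintro x a ha rfl h
    exact ha (hπ.dvd_of_mul_eq_zero a (by simpa using h))
  rcases hp.eq_two_or_odd with rfl | hodd
  · obtain ⟨b, hb0, hb1⟩ : ∃ b : F, b ≠ 0 ∧ b ≠ -1 := by
      by_contra! hcon
      have : (Set.univ : Set F) ⊆ {0, -1} := fun b _ => by
        by_cases h : b = 0
        · exact Or.inl h
        · exact Or.inr (hcon b h)
      have h2 := Set.ncard_le_ncard this (Set.toFinite _)
      rw [Set.ncard_univ] at h2
      have := Set.ncard_insert_le (0 : F) {-1}
      rw [Set.ncard_singleton] at this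
      omega
    obtain ⟨w, rfl⟩ := hπ.surjective b
    have hw : ¬ ((2 : ℕ) : R) ∣ w + w ^ 2 := by
      rw [← hπ.map_eq_zero_iff, map_add, map_pow,
        show π w + π w ^ 2 = π w * (π w + 1) by ring]
      exact mul_ne_zero hb0 fun h => hb1 (eq_neg_of_add_eq_zero_left h)
    refine ⟨1 + (2 : ℕ) * w, ⟨w, by ring⟩, ?_⟩
    rcases Nat.lt_or_ge k 3 with h3 | h3
    · obtain rfl : k = 2 := by omega
      refine finish _ w (fun h => hw ?_) (by simp)
      exact dvd_add h (h.trans (dvd_pow_self _ two_ne_zero))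
    · obtain ⟨j, rfl⟩ := Nat.exists_eq_add_of_le h3
      obtain ⟨y, hy⟩ := ZMod.exists_one_add_mul_pow_prime_pow_eq (u := ((2 : ℕ) : R) ^ 2)
        (v := ((2 : ℕ) : R)) hp (dvd_pow_self _ two_ne_zero)
        ⟨1, by push_cast; ring⟩ (w + w ^ 2) j
      refine finish _ (w + w ^ 2 + (2 : ℕ) * y) ?_ ?_
      · rwa [dvd_add_left (dvd_mul_right _ _)]
      · rw [show 3 + j - 2 = 1 + j by omega, show 3 + j - 1 = j + 2 by omega, pow_add 2 1 j,
          pow_mul, pow_add _ j 2, ← hy]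
        congr 1
        push_cast; ring
  · have h3 : 3 ≤ p := by have := hp.two_le; omega
    obtain ⟨j, rfl⟩ := Nat.exists_eq_add_of_le hk
    obtain ⟨y, hy⟩ := ZMod.exists_one_add_mul_pow_prime_pow_eq (u := (p : R))
      (v := (p : R)) hp dvd_rfl
      (by rw [← pow_three']; exact pow_dvd_pow _ h3) 1 j
    refine ⟨1 + p * 1, ⟨1, by ring⟩, ?_⟩
    refine finish _ (1 + p * y) ?_ ?_
    · rw [dvd_add_left (dvd_mul_right _ _)]
      exact hπ.not_dvd_one
    · rw [show 2 + j - 2 = j by omega, show 2 + j - 1 = j + 1 by omega, pow_succ, ← hy]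

theorem forall_isUnit_pow_eq_one_iff [Fact p.Prime] (hπ : IsReduction p k π) (hk : 1 ≤ k) {d : ℕ}
    (hF : Nat.card F = p ^ d) (hd : d ≠ 0) (hdk : k = 1 ∨ 2 ≤ d) (n : ℕ) :
    (∀ x : R, IsUnit x → x ^ n = 1) ↔ p ^ (k - 1) * (p ^ d - 1) ∣ n := by
  have hp : p.Prime := Fact.out
  have : Finite F := Nat.finite_of_card_ne_zero (by rw [hF]; exact pow_ne_zero _ hp.ne_zero)
  have hcop : Nat.Coprime p (p ^ d - 1) := by
    rw [hp.coprime_iff_not_dvd]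
    intro h
    have h1 : p ∣ p ^ d := dvd_pow_self p hd
    have := (Nat.dvd_sub_iff_right (Nat.one_le_pow _ _ hp.pos) h1).1 h
    exact hp.one_lt.ne' (Nat.dvd_one.1 this)
  constructor
  · intro h
    -- The two factors are coprime, so each is treated alone, as the order of a suitable unit.
    refine (Nat.Coprime.pow_left _ hcop).mul_dvd_of_dvd_of_dvd ?_ ?_
    · rcases Nat.lt_or_ge k 2 with hk2 | hk2
      · rw [show k - 1 = 0 by omega, pow_zero]; exact one_dvd _
      have hd2 : 2 ≤ d := by omega
      have hcard : 2 < Nat.card F := by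
        rw [hF]
        calc 2 < 2 ^ 2 := by norm_num
          _ ≤ p ^ 2 := Nat.pow_le_pow_left hp.two_le 2
          _ ≤ p ^ d := Nat.pow_le_pow_right hp.pos hd2
      obtain ⟨x, hx1, hx⟩ := hπ.exists_one_add_pow_ne_one hk2 hcard
      have hxu : IsUnit x := by
        rw [hπ.isUnit_iff]
        intro hdvd
        exact hπ.not_dvd_one ((dvd_sub_right hdvd).1 hx1)
      have hord : orderOf x = p ^ (k - 2 + 1) :=
        orderOf_eq_prime_pow hx (by
          rw [show k - 2 + 1 = k - 1 by omega]
          exact hπ.pow_prime_pow_eq_one hk hx1)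
      rw [show k - 1 = k - 2 + 1 by omega, ← hord]
      exact orderOf_dvd_of_pow_eq_one (h x hxu)
    · obtain ⟨g, hg⟩ := IsCyclic.exists_ofOrder_eq_natCard (α := Fˣ)
      rw [Nat.card_units, hF] at hg
      rw [← hg]
      apply orderOf_dvd_of_pow_eq_one
      obtain ⟨x, hx⟩ := hπ.surjective g
      have hxu : IsUnit x := by
        rw [hπ.isUnit_iff, ← hπ.map_eq_zero_iff, hx]
        exact g.ne_zero
      ext
      rw [Units.val_pow_eq_pow_val, ← hx, ← map_pow, h x hxu, map_one, Units.val_one]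
  · rintro ⟨t, rfl⟩ x hx
    have h1 : (p : R) ∣ x ^ (p ^ d - 1) - 1 := by
      rw [← hπ.map_eq_zero_iff, map_sub, map_pow, map_one, sub_eq_zero, ← hF]
      have := pow_card_eq_one' (x := (hx.map π).unit)
      rw [Nat.card_units] at this
      simpa using congrArg Units.val this
    rw [pow_mul, mul_comm, pow_mul, hπ.pow_prime_pow_eq_one hk h1, one_pow]

/-! ### Coincidence of power maps, period and onset -/

theorem forall_pow_eq_pow_iff (hπ : IsReduction p k π) {L : ℕ}
    (hL : ∀ n, (∀ x : R, IsUnit x → x ^ n = 1) ↔ L ∣ n) {m n : ℕ} (hmn : m < n) :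
    (∀ x : R, x ^ n = x ^ m) ↔ k ≤ m ∧ L ∣ n - m := by
  rw [← hL]
  constructor
  · refine fun h => ⟨hπ.pow_eq_pow_imp_le hmn (h p), fun x hx => ?_⟩
    apply (hx.pow m).mul_left_cancel
    rw [← pow_add, Nat.add_sub_cancel' hmn.le, h, mul_one]
  · rintro ⟨hkm, h⟩ x
    by_cases hx : IsUnit x
    · rw [← Nat.add_sub_cancel' hmn.le, pow_add, h x hx, mul_one]
    · rw [hπ.isUnit_iff, not_not] at hx
      rw [hπ.pow_eq_zero_of_dvd hx hkm, hπ.pow_eq_zero_of_dvd hx (hkm.trans hmn.le)]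

theorem hasExpPeriod (hπ : IsReduction p k π) (hk : 1 ≤ k) {L : ℕ} (hL0 : 0 < L)
    (hL : ∀ n, (∀ x : R, IsUnit x → x ^ n = 1) ↔ L ∣ n) : HasExpPeriod R L := by
  refine ⟨⟨hL0, fun x => ⟨k, hk, ?_⟩⟩, ?_⟩
  · exact (hπ.forall_pow_eq_pow_iff hL (by omega)).2 ⟨le_rfl, by simp⟩ x
  · rintro n ⟨hn, h⟩
    refine Nat.le_of_dvd hn ((hL n).1 fun x hx => ?_)
    obtain ⟨m, -, hm⟩ := h x
    apply (hx.pow m).mul_left_cancel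
    rw [← pow_add, hm, mul_one]

theorem hasExpOnset (hπ : IsReduction p k π) (hk : 1 ≤ k) {L : ℕ} (hL0 : 0 < L)
    (hL : ∀ n, (∀ x : R, IsUnit x → x ^ n = 1) ↔ L ∣ n) : HasExpOnset R k := by
  have hmem : ∀ x : R, x ^ (k + L) = x ^ k :=
    (hπ.forall_pow_eq_pow_iff hL (by omega)).2 ⟨le_rfl, by simp⟩
  refine ⟨L, hπ.hasExpPeriod hk hL0 hL, ⟨p, ⟨hk, hmem p⟩, ?_⟩, ?_⟩
  · rintro j ⟨-, h⟩
    exact hπ.pow_eq_pow_imp_le (by omega) h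
  · rintro m ⟨x, hx⟩
    exact hx.2 ⟨hk, hmem x⟩

/-! ### Periodic power maps -/

theorem exists_periodic_pow_iff [Fact p.Prime] (hπ : IsReduction p k π) (hk : 1 ≤ k) {n : ℕ}
    (hn : 0 < n) :
    (∃ h : R, h ≠ 0 ∧ Function.Periodic (fun x : R => x ^ n) h) ↔ 2 ≤ k ∧ p ∣ n := by
  constructor
  · rintro ⟨h, h0, hper⟩
    -- Periodicity at `0` gives `h ^ n = 0`, so `h` is not a unit.
    have hh : (p : R) ∣ h := by
      by_contra hndvd
      have h1 := hper 0
      simp only [zero_add, zero_pow hn.ne'] at h1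
      have h2 := (hπ.isUnit_iff.2 hndvd).pow n
      rw [h1] at h2
      exact hπ.isUnit_iff.1 h2 (dvd_zero _)
    refine ⟨?_, ?_⟩
    · by_contra hlt
      obtain rfl : k = 1 := by omega
      exact h0 (by simpa using hπ.pow_eq_zero_of_dvd hh le_rfl)
    -- Periodicity at `1` gives `(1 + h) ^ n = 1`, while the principal unit `1 + h` has order a
    -- power of `p`.
    · by_contra hpn
      have hcop : Nat.Coprime (p ^ (k - 1)) n :=
        Nat.Coprime.pow_left _ (((Fact.out : p.Prime).coprime_iff_not_dvd).2 hpn)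
      have h1 : (1 + h) ^ n = 1 := by simpa using hper 1
      have h2 : (1 + h) ^ p ^ (k - 1) = 1 :=
        hπ.pow_prime_pow_eq_one hk (by simpa using hh)
      have h3 : orderOf (1 + h) = 1 := Nat.eq_one_of_dvd_coprimes hcop
        (orderOf_dvd_of_pow_eq_one h2) (orderOf_dvd_of_pow_eq_one h1)
      exact h0 (by simpa using orderOf_eq_one_iff.1 h3)
  · rintro ⟨hk2, t, rfl⟩
    -- In the expansion of `(x + p ^ (k - 1)) ^ p` the linear term contains `p ^ k`, and the others
    -- contain `p ^ (2 * (k - 1))`, zero since `k ≥ 2`.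
    refine ⟨(p : R) ^ (k - 1), hπ.pow_pred_ne_zero, fun x => ?_⟩
    obtain ⟨c, hc⟩ := Polynomial.powAddExpansion x ((p : R) ^ (k - 1)) p
    have hsq : ((p : R) ^ (k - 1)) ^ 2 = 0 := by
      rw [← pow_mul]
      exact pow_eq_zero_of_le (by omega) hπ.pow_eq_zero
    have hp : (p : R) * (p : R) ^ (k - 1) = 0 := by
      rw [← pow_succ', Nat.sub_add_cancel hk, hπ.pow_eq_zero]
    have : (x + (p : R) ^ (k - 1)) ^ p = x ^ p := by
      rw [hc, hsq, mul_zero, add_zero, mul_right_comm, hp, zero_mul, add_zero]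
    simp only [pow_mul, this]

/-! ### Counting -/

theorem powerMaps_filter_ncard (hπ : IsReduction p k π) (hk : 1 ≤ k) {L : ℕ} (hL0 : 0 < L)
    (hL : ∀ n, (∀ x : R, IsUnit x → x ^ n = 1) ↔ L ∣ n) (P : (R → R) → Prop) (Q : ℕ → Prop)
    [DecidablePred Q] (hPQ : ∀ n, 0 < n → (P (fun x => x ^ n) ↔ Q n)) :
    {f | f ∈ powerMaps R ∧ P f}.ncard = ((Finset.Ioc 0 (L + (k - 1))).filter Q).card := by
  have himage : {f | f ∈ powerMaps R ∧ P f} =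
      (fun (n : ℕ) (x : R) => x ^ n) '' ((Finset.Ioc 0 (L + (k - 1))).filter Q : Finset ℕ) := by
    ext f
    simp only [Set.mem_ofPred_eq, Set.mem_image, Finset.mem_coe, Finset.mem_filter,
      Finset.mem_Ioc, powerMaps]
    constructor
    · rintro ⟨⟨n, hn, rfl⟩, hP⟩
      rcases Nat.lt_or_ge (L + (k - 1)) n with hlt | hle
      -- A larger exponent is reduced modulo `L` into the window from `k` to `k + L - 1`.
      · have hmod := Nat.mod_lt (n - k) hL0
        have hmodle := Nat.mod_le (n - k) L
        have hfun : (fun x : R => x ^ (k + (n - k) % L)) = fun x => x ^ n := by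
          funext x
          refine ((hπ.forall_pow_eq_pow_iff hL (by omega)).2 ⟨by omega, ?_⟩ x).symm
          rw [← Nat.sub_sub]
          exact Nat.dvd_sub_mod _
        refine ⟨k + (n - k) % L, ⟨⟨by omega, by omega⟩, ?_⟩, hfun⟩
        rw [← hPQ _ (by omega), hfun]
        exact hP
      · exact ⟨n, ⟨⟨hn, hle⟩, (hPQ n hn).1 hP⟩, rfl⟩
    · rintro ⟨n, ⟨⟨hn, -⟩, hQ⟩, rfl⟩
      exact ⟨⟨n, hn, rfl⟩, (hPQ n hn).2 hQ⟩
  have hne : ∀ m n, 0 < m → m < n → n ≤ L + (k - 1) →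
      (fun x : R => x ^ n) ≠ fun x : R => x ^ m := by
    intro m n hm hmn hn h
    obtain ⟨hkm, hdvd⟩ := (hπ.forall_pow_eq_pow_iff hL hmn).1 fun x => congrFun h x
    have := Nat.le_of_dvd (by omega) hdvd
    omega
  rw [himage, Set.InjOn.ncard_image, Set.ncard_coe_finset]
  intro m hm n hn h
  simp only [Finset.mem_coe, Finset.mem_filter, Finset.mem_Ioc] at hm hn
  rcases lt_trichotomy m n with hlt | heq | hgt
  · exact absurd h.symm (hne m n hm.1.1 hlt hn.1.2)
  · exact heq
  · exact absurd h (hne n m hn.1.1 hgt hm.1.2)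

theorem powerMaps_ncard (hπ : IsReduction p k π) (hk : 1 ≤ k) {L : ℕ} (hL0 : 0 < L)
    (hL : ∀ n, (∀ x : R, IsUnit x → x ^ n = 1) ↔ L ∣ n) :
    (powerMaps R).ncard = L + (k - 1) := by
  simpa using hπ.powerMaps_filter_ncard hk hL0 hL (fun _ => True) (fun _ => True) (by simp)

theorem periodicPowerMaps_ncard [Fact p.Prime] (hπ : IsReduction p k π) (hk : 2 ≤ k) {L : ℕ}
    (hL0 : 0 < L) (hL : ∀ n, (∀ x : R, IsUnit x → x ^ n = 1) ↔ L ∣ n) :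
    (periodicPowerMaps R).ncard = (L + (k - 1)) / p := by
  rw [← Nat.Ioc_filter_dvd_card_eq_div]
  refine hπ.powerMaps_filter_ncard (by omega) hL0 hL _ _ fun n hn => ?_
  rw [hπ.exists_periodic_pow_iff (by omega) hn]
  exact and_iff_right hk

theorem periodicPowerMaps_eq_empty [Fact p.Prime] (hπ : IsReduction p 1 π) :
    periodicPowerMaps R = ∅ := by
  rw [Set.eq_empty_iff_forall_notMem]
  rintro _ ⟨⟨n, hn, rfl⟩, h⟩
  have := (hπ.exists_periodic_pow_iff le_rfl hn).1 h
  omega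

theorem nonempty_ringEquiv (hπ : IsReduction p 1 π) : Nonempty (R ≃+* F) := by
  refine ⟨RingEquiv.ofBijective π ⟨(injective_iff_map_eq_zero π).2 fun x hx => ?_,
    hπ.surjective⟩⟩
  simpa using hπ.pow_eq_zero_of_dvd ((hπ.map_eq_zero_iff x).1 hx) le_rfl

theorem nonempty_ringEquiv_galoisField [Fact p.Prime] (hπ : IsReduction p 1 π) {d : ℕ}
    (hF : Nat.card F = p ^ d) : Nonempty (R ≃+* GaloisField p d) := by
  obtain ⟨e⟩ := hπ.nonempty_ringEquiv
  have : CharP F p := (CharP.charP_iff_prime_eq_zero Fact.out).2 hπ.map_natCast_eq_zero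
  let : Algebra (ZMod p) F := ZMod.algebra F p
  exact ⟨e.trans (GaloisField.algEquivGaloisField p d hF).toRingEquiv⟩

end IsReduction

theorem mainTheorem10 (p k d : ℕ) [Fact p.Prime] (R : Type*) [CommRing R]
    (hR : IsGaloisRing p k d R) :
    (2 ≤ d → 2 ≤ k →
      HasExpOnset R k ∧
      HasExpPeriod R (p ^ (k - 1) * (p ^ d - 1)) ∧
      (powerMaps R).ncard = p ^ (k - 1) * (p ^ d - 1) + (k - 1) ∧
      (periodicPowerMaps R).ncard = p ^ (k - 2) * (p ^ d - 1) + (k - 1) / p) ∧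
    (k = 1 →
      Nonempty (R ≃+* GaloisField p d) ∧
      HasExpOnset R 1 ∧
      HasExpPeriod R (p ^ d - 1) ∧
      (powerMaps R).ncard = p ^ d - 1 ∧
      periodicPowerMaps R = ∅) := by
  have hp : p.Prime := Fact.out
  have hd := hR.ne_zero
  have hq : 0 < p ^ d - 1 := Nat.sub_pos_of_lt (Nat.one_lt_pow hd hp.one_lt)
  refine ⟨fun hd2 hk => ?_, ?_⟩
  · obtain ⟨F, _, π, hF, hπ⟩ := hR.exists_isReduction (by omega)
    have hk1 : 1 ≤ k := by omega
    have hL := hπ.forall_isUnit_pow_eq_one_iff hk1 hF hd (Or.inr hd2)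
    have hL0 : 0 < p ^ (k - 1) * (p ^ d - 1) := Nat.mul_pos (Nat.pow_pos hp.pos) hq
    refine ⟨hπ.hasExpOnset hk1 hL0 hL, hπ.hasExpPeriod hk1 hL0 hL,
      hπ.powerMaps_ncard hk1 hL0 hL, ?_⟩
    -- As `k ≥ 2`, `p` divides `L`, so the floor acts on `k - 1` alone.
    rw [hπ.periodicPowerMaps_ncard hk hL0 hL, show k - 1 = (k - 2) + 1 by omega, pow_succ',
      mul_assoc, Nat.mul_add_div hp.pos]
  · rintro rfl
    obtain ⟨F, _, π, hF, hπ⟩ := hR.exists_isReduction le_rfl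
    have hL : ∀ n, (∀ x : R, IsUnit x → x ^ n = 1) ↔ p ^ d - 1 ∣ n := by
      simpa using hπ.forall_isUnit_pow_eq_one_iff le_rfl hF hd (Or.inl rfl)
    exact ⟨hπ.nonempty_ringEquiv_galoisField hF, hπ.hasExpOnset le_rfl hq hL,
      hπ.hasExpPeriod le_rfl hq hL, by simpa using hπ.powerMaps_ncard le_rfl hq hL,
      hπ.periodicPowerMaps_eq_empty⟩
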